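/- Let $n\ge 1$ be an integer, $q=2^n$ and $d=q^3+q^2+q-1$. For a prime power $r$ and $m\ge1$ put $\mathrm{Tr}_r^{r^m}(x)=\sum_{i=0}^{m-1}x^{r^i}$ and $\mathrm{N}_r^{r^m}(x)=\prod_{i=0}^{m-1}x^{r^i}$, and let $\mu_{q+1}=\{x\in\mathbb F_{q^4}^*: x^{q+1}=1\}$. For $c\in\mathbb F_{q^4}$ put $$\mathfrak t'=\mathfrak t+\mathfrak t^{\,q}\ \text{ with }\ \mathfrak t=\mathrm{Tr}_{q^2}^{q^4}(c),\qquad \mathfrak n'=\mathrm N_{q^2}^{q^4}(c)+1,$$ and let $$\Lambda=\Big\{c\in\mathbb F_{q^4}^*:\ \mathfrak t'\ne 0\ \text{ and }\ \mathrm{Tr}_2^{q}\Big(\frac{\mathfrak n'^{\frac{q+1}2}}{\mathfrak t'}\Big)=1\Big\},$$ where $y^{1/2}$ denotes the unique square root of $y$ in $\mathbb F_{q^4}$ and $y^{\frac{q+1}{2}}=(y^{1/2})^{q+1}$. Then for every $b\in\mathbb F_{q^4}$ the number of solutions $x\in\mathbb F_{q^4}$ of $x^d+(x+1)^d=b$ is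 $$\begin{cases} q^2, & b=1,\\ q^2-q, & b\in\mu_{q+1}\setminus\{1\},\\ 2, & b\in\Lambda,\\ 0, & \text{otherwise.}\end{cases}$$ Write $f(x)=x^d$ on $\mathbb F_{q^4}$, $\delta_f(a,b)=|\{x\in\mathbb F_{q^4}: f(a+x)+f(x)=b\}|$ and $w_i=|\{b\in\mathbb F_{q^4}:\delta_f(1,b)=i\}|$. Then the differential uniformity $\max\{\delta_f(a,b): a\in\mathbb F_{q^4}^*,\ b\in\mathbb F_{q^4}\}$ of $f$ equals $q^2$, and $$w_0=\big(\tfrac12q^3-1\big)(q+1),\qquad w_{q^2}=1,$$ and, if $n\ge 2$, $$w_2=\tfrac12q^3(q-1),\qquad w_{q^2-q}=q,$$ while if $n=1$ (where $q^2-q=2$) $w_2=\tfrac12q^3(q-1)+q=6$. All other $w_i$ are $0$. Consequently the conjecture of Budaghyan, Calderini, Carlet, Davidova and Kaleyski holds: there are an element $b_0\in\mathbb F_{q^4}$ and a set $S\subseteq\mathbb F_{q^4}\setminus\{b_0\}$ of $q$ elements such that $x^d+(x+1)^d=b$ has $q^2$ solutions in $\mathbb F_{q^4}$ for $b=b_0$,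 $q^2-q$ solutions for each $b\in S$, and at most $2$ solutions for every other $b\in\mathbb F_{q^4}$. -/

import Mathlib

/-- The trace from the field with `r ^ m` elements to the field with `r` elements,
`x ↦ x + x ^ r + ⋯ + x ^ (r ^ (m - 1))`. -/
def finTrace {F : Type*} [Field F] (r m : ℕ) (x : F) : F :=
  ∑ i ∈ Finset.range m, x ^ (r ^ i)

/-- The norm from the field with `r ^ m` elements to the field with `r` elements,
`x ↦ x * x ^ r * ⋯ * x ^ (r ^ (m - 1))`. -/
def finNorm {F : Type*} [Field F] (r m : ℕ) (x : F) : F :=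
  ∏ i ∈ Finset.range m, x ^ (r ^ i)

/-- The set of `s`-th roots of unity in `F`. -/
def rootsSet (F : Type*) [Field F] (s : ℕ) : Set F := {x | x ≠ 0 ∧ x ^ s = 1}

/-- The square root `y ^ (1/2)` in a field with `q ^ 4` elements, `q` even. -/
def halfPower {F : Type*} [Field F] (q : ℕ) (y : F) : F := y ^ (q ^ 4 / 2)

/-- In a field with `q ^ 4` elements, `q` a positive power of `2`, `halfPower q y` is the
unique element whose square is `y`. -/
theorem sq_eq_iff_eq_halfPower {F : Type*} [Field F] [Finite F] {n q : ℕ} (hn : 1 ≤ n)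
    (hq : q = 2 ^ n) (hF : Nat.card F = q ^ 4) (y z : F) :
    z ^ 2 = y ↔ z = halfPower q y := by
  have : Fintype F := Fintype.ofFinite F
  rw [Nat.card_eq_fintype_card] at hF
  have h2 : 2 * (q ^ 4 / 2) = q ^ 4 := by
    apply Nat.mul_div_cancel'
    rw [hq]
    exact dvd_pow (dvd_pow_self 2 (by omega)) (by norm_num)
  have hp (w : F) : w ^ (q ^ 4) = w := by rw [← hF]; exact FiniteField.pow_card w
  unfold halfPower
  constructor
  · rintro rfl
    rw [← pow_mul, h2, hp]
  · rintro rfl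
    rw [← pow_mul, mul_comm, h2, hp]

/-- The set `Λ` of nonzero `c` such that, with `t' = t + t ^ q` for the relative trace
`t = c + c ^ (q ^ 2)` and `n' = N + 1` for the relative norm `N = c * c ^ (q ^ 2)`,
one has `t' ≠ 0` and the absolute trace of `n' ^ ((q + 1) / 2) / t'` is `1`.
Here `q = 2 ^ n` and `F` has `q ^ 4` elements. -/
def Lambda (F : Type*) [Field F] (n q : ℕ) : Set F :=
  {c | c ≠ 0 ∧
    finTrace (q ^ 2) 2 c + finTrace (q ^ 2) 2 c ^ q ≠ 0 ∧
    finTrace 2 n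
      (halfPower q (finNorm (q ^ 2) 2 c + 1) ^ (q + 1) /
        (finTrace (q ^ 2) 2 c + finTrace (q ^ 2) 2 c ^ q)) = 1}

/-- The number `δ_f(a, b)` of `x` with `f (a + x) + f x = b`. -/
noncomputable def diffCount {F : Type*} [Field F] (f : F → F) (a b : F) : ℕ :=
  {x : F | f (a + x) + f x = b}.ncard

/-- The differential uniformity: the maximum of `δ_f(a, b)` over `a ≠ 0` and all `b`
(`F` finite). -/
noncomputable def diffUniformity {F : Type*} [Field F] (f : F → F) : ℕ :=
  sSup {k | ∃ a b : F, a ≠ 0 ∧ diffCount f a b = k}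

/-- The entry `w_i` of the differential spectrum: the number of `b` with `δ_f(1, b) = i`. -/
noncomputable def diffSpectrum {F : Type*} [Field F] (f : F → F) (i : ℕ) : ℕ :=
  {b : F | diffCount f 1 b = i}.ncard

/-!
Let `σ x = x ^ q` and write `y, z, w` for `σ x, σ² x, σ³ x`. Since `x * x ^ d = y z w`, the equation
`x ^ d + (x + 1) ^ d = b` becomes, for `x ≠ 0, 1`, the polynomial equation `IsDerivSol σ b x` in the
conjugates of `x`. With the norm `p = x z`, the norm `r = (x + 1) (z + 1)`, their conjugates
`p' = y w` and `r' = (y + 1) (w + 1)`, and `s = x + z`, it says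
`b = (p' / p) z ^ 2 + (r' / r) (z + 1) ^ 2`. Put `g = p r` and `v = p r' + p' r`; let a prime denote
application of `σ`, let `c = σ² b`, and let `t = b + c + b' + c'`, `m = b c + 1`.

* `b = 1` exactly when `x` is fixed by `σ²` (`isDerivSol_one_iff`), which gives `q ^ 2` solutions.
* For other `x`, adding the equation and its conjugate gives `(b + c) g = s ^ 2 v`. So `b` lies in
  the field of `q ^ 2` elements if and only if `v = 0`, that is `p' / p = r' / r`; this common ratio
  is then `b`, which therefore is a `(q + 1)`-st root of unity (`unit_of_isDerivSol`).
* If `v ≠ 0`, multiplying the equation and its conjugate gives `m g = s' ^ 2 g + s ^ 2 g'`, and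
  hence `k := m' / t = g / v`. With `U = p r' / v` one has `U' = U + 1`, `U ^ 2 + U = k k'`, and the
  equation reads `k b = z ^ 2 + U`, so that `x ^ 2 = k c + U` (`sq_eq_of_isDerivSol`). As
  `k k' = m m' / t ^ 2` is the square of the element whose trace defines `Λ`, telescoping the trace
  of `U ^ 2 + U` shows that `b ∈ Λ` if and only if `t ≠ 0` and there is a `U` with these two
  properties (`mem_Lambda_iff`). The factorization of `t` gives `t ≠ 0` (`norm_add_norm_ne_zero`).
  Conversely every such `U` yields a solution (`isDerivSol_of_sq_eq`); since `U` is unique up to adding `1`,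
  the fibre over `b ∈ Λ` consists of two elements.
* For a root of unity `b ≠ 1`, the solutions are the `x` not fixed by `σ²` with `p' = b p` and
  `(s + 1)' = b (s + 1)`. In suitable coordinates they correspond to the pairs `(α, γ)` with `α` in
  the field of `q` elements, `γ` in that of `q ^ 2` elements and `α ^ 2 + α = ν N(γ)`
  (`unit_fibre_eq_image`). Each nonzero value of the norm is taken `q + 1` times, so there are
  `2 + (q - 2) (q + 1) = q ^ 2 - q` of them (`ncard_normPairs`).

The size of `Λ`, and with it the spectrum, follows by adding up the sizes of all fibres.
-/

/-- The equation `x ^ d + (x + 1) ^ d = b` multiplied by `x * (x + 1)`, where `d + 1 = q + q² + q³`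
and `σ` is the `q`-power map. It holds trivially for `x = 0` and `x = 1`. -/
def IsDerivSol {F : Type*} [Field F] (σ : F →+* F) (b x : F) : Prop :=
  b * (x * (x + 1)) = σ x * σ (σ x) * σ (σ (σ x)) * (x + 1) +
    (σ x + 1) * (σ (σ x) + 1) * (σ (σ (σ x)) + 1) * x

/-! ### The equation in terms of conjugates -/

section ringhom

variable {F : Type*} [Field F] {σ : F →+* F}

theorem isDerivSol_add_one [CharP F 2] {b x : F} (h : IsDerivSol σ b x) :
    IsDerivSol σ b (x + 1) := by
  unfold IsDerivSol at *
  simp only [map_add, map_one]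
  grind

theorem isDerivSol_one_iff [CharP F 2] (hσ : ∀ x, σ (σ (σ (σ x))) = x) {x : F} :
    IsDerivSol σ 1 x ↔ σ (σ x) = x := by
  unfold IsDerivSol
  constructor
  · intro h
    have hy : ∀ u v : F, σ u = σ v → u = v := fun u v => (RingHom.injective σ).eq_iff.1
    have h' := congrArg σ h
    simp only [map_mul, map_add, map_one, hσ] at h'
    generalize hY : σ x = y at *
    generalize hZ : σ y = z at *
    generalize hW : σ z = w at *
    -- The equation and its conjugate say that `x` and `y` are roots of `e₁ X + e₃`, where `e₁` and
    -- `e₃` are elementary symmetric functions of `x, y, z, w`; subtract them.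
    have hsum : (x + y + z + w) * (x + y) = 0 := by grind
    rcases mul_eq_zero.1 hsum with h1 | h1
    -- Here `e₁ = 0`, so that `e₃ = (x + z) (x z + y w)` vanishes too.
    · have h2 : (x + z) * (x * z + y * w) = 0 := by grind
      rcases mul_eq_zero.1 h2 with h3 | h3
      · grind
      · have h4 : (x + y) * (y + z) = 0 := by grind
        rcases mul_eq_zero.1 h4 with h5 | h5
        · grind
        · have : x = y := hy _ _ (by grind)
          grind
    · have : x = y := by grind
      subst this
      rw [hY] at hZ
      exact hZ.symm
  · intro h
    rw [h]
    grind

variable {b c b' c' x y z w : F}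

/-- The equation in the form `b = (p' / p) z ^ 2 + (r' / r) (z + 1) ^ 2`, cleared of denominators. -/
theorem deriv_mul_norm_eq
    (hb : b * (x * (x + 1)) = y * z * w * (x + 1) + (y + 1) * (z + 1) * (w + 1) * x) :
    b * (x * z * ((x + 1) * (z + 1))) =
      y * w * ((x + 1) * (z + 1)) * z ^ 2 + (y + 1) * (w + 1) * (x * z) * (z + 1) ^ 2 := by
  linear_combination z * (z + 1) * hb

/-- The product of the equations for `b` and its conjugate `c`, in the form
`(b c + 1) g = s' ^ 2 g + s ^ 2 g'`. -/
theorem deriv_mul_conj_add_one [CharP F 2] (hx : x ≠ 0) (hx1 : x + 1 ≠ 0) (hz : z ≠ 0)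
    (hz1 : z + 1 ≠ 0)
    (hb : b * (x * (x + 1)) = y * z * w * (x + 1) + (y + 1) * (z + 1) * (w + 1) * x)
    (hc : c * (z * (z + 1)) = w * x * y * (z + 1) + (w + 1) * (x + 1) * (y + 1) * z) :
    (b * c + 1) * (x * z * ((x + 1) * (z + 1))) =
      (y + w) ^ 2 * (x * z * ((x + 1) * (z + 1))) +
        (x + z) ^ 2 * (y * w * ((y + 1) * (w + 1))) := by
  have h0 : x * (x + 1) * (z * (z + 1)) ≠ 0 := by simp [*]
  refine mul_right_cancel₀ h0 ?_
  have h := congrArg₂ (· * ·) hb hc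
  linear_combination (norm := skip) x * (x + 1) * (z * (z + 1)) * h
  clear * -
  grind

/-- With `x ^ 2 = k c + U` and `z ^ 2 = k b + U`, this is `p' ^ 2 U ^ 2 = k' ^ 2 p ^ 2`: the relation
`p' / p = k' / U` between the norm of the candidate solution and its conjugate. -/
theorem conj_norm_mul_sq_eq [CharP F 2] {k k' U : F} {t : F} (hk : k * t = b' * c' + 1)
    (hk' : k' * t = b * c + 1) (ht : t = b + c + (b' + c')) (hU : U ^ 2 + U = k * k') :
    (k' * c' + U + 1) * (k' * b' + U + 1) * U ^ 2 = k' ^ 2 * ((k * c + U) * (k * b + U)) := by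
  have h1 : (k * c + U) * (k * b + U) =
    k * (k * k' * t + k + k') + U * (k * (b + c) + 1) := by grind
  have h2 : (k' * c' + U + 1) * (k' * b' + U + 1) =
    k' * (k * k' * t + k + k') + (U + 1) * (k' * (b' + c') + 1) := by grind
  rw [h1, h2]
  generalize b * c = n at *
  grind

/-- The factor `s' ^ 2 g + s ^ 2 g'` of the trace `t` does not vanish: otherwise `g / s ^ 2` would be
fixed by `σ`, and so `η ^ 2 + η = g / s ^ 2` with `η = x (z + 1) / s` would force `η`, and then `x`,
to be fixed by `σ²`. -/
theorem norm_add_norm_ne_zero [CharP F 2]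
    (hσ : ∀ x, σ (σ (σ (σ x))) = x) (hx : σ (σ x) ≠ x) :
    (σ x + σ (σ (σ x))) ^ 2 * (x * σ (σ x) * ((x + 1) * (σ (σ x) + 1))) +
    (x + σ (σ x)) ^ 2 * (σ x * σ (σ (σ x)) * ((σ x + 1) * (σ (σ (σ x)) + 1))) ≠ 0 := by
  intro hD
  have hs : x + σ (σ x) ≠ 0 := by grind
  set η := x * (σ (σ x) + 1) / (x + σ (σ x)) with hη
  have h1 : σ η = σ x * (σ (σ (σ x)) + 1) / (σ x + σ (σ (σ x))) := by simp [hη]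
  have h2 : σ (σ η) = σ (σ x) * (x + 1) / (σ (σ x) + x) := by simp [h1, hσ]
  have hs' : σ x + σ (σ (σ x)) ≠ 0 := by
    rw [← map_add]; exact (map_ne_zero σ).2 hs
  have h3 : (σ η + η) * (σ η + η + 1) = 0 := by
    rw [h1, hη]
    generalize σ (σ (σ x)) = w at *
    generalize σ (σ x) = z at *
    generalize σ x = y at *
    field_simp
    grind
  have h4 : σ (σ η) = η := by
    rcases mul_eq_zero.1 h3 with h | h
    · have : σ η = η := by grind
      rw [this, this]
    · have : σ η = η + 1 := by grind
      rw [this, map_add, this, map_one]; grind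
  rw [h2, hη] at h4
  have h5 : σ (σ x) + x ≠ 0 := by grind
  field_simp at h4
  grind

theorem norm_ne_zero_of_not_fixed [CharP F 2] {x : F} (hx : σ (σ x) ≠ x) :
    x * σ (σ x) * ((x + 1) * (σ (σ x) + 1)) ≠ 0 ∧ x + σ (σ x) ≠ 0 := by
  have h0 : x ≠ 0 := by rintro rfl; simp at hx
  have h1 : x + 1 ≠ 0 := by
    intro h; apply hx; rw [CharTwo.add_eq_zero.1 h]; simp
  have hz : ∀ {u : F}, u ≠ 0 → σ (σ u) ≠ 0 := fun hu => by simpa using hu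
  refine ⟨mul_ne_zero (mul_ne_zero h0 (hz h0)) (mul_ne_zero h1 ?_), ?_⟩
  · simpa using hz h1
  · intro h; exact hx (CharTwo.add_eq_zero.1 h).symm

/-- A solution outside the field of `q ^ 2` elements, for `b` inside it, makes `b` a root of unity,
and the norm of `x` and the trace of `x` plus `1` are multiplied by `b` under `σ`. -/
theorem unit_of_isDerivSol [CharP F 2] (hσ : ∀ x, σ (σ (σ (σ x))) = x) {b x : F} (hx : σ (σ x) ≠ x)
    (hb : σ (σ b) = b) (h : IsDerivSol σ b x) :
    σ b * b = 1 ∧ σ (x * σ (σ x)) = b * (x * σ (σ x)) ∧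
      σ (x + σ (σ x) + 1) = b * (x + σ (σ x) + 1) := by
  obtain ⟨hg, hs⟩ := norm_ne_zero_of_not_fixed hx
  have h' := congrArg (fun u => σ (σ u)) h
  simp only [map_mul, map_add, map_one, hσ, hb] at h'
  have e1 := deriv_mul_norm_eq h
  have e2 := deriv_mul_norm_eq h'
  have h1 : σ (x * σ (σ x)) = b * (x * σ (σ x)) ∧
      σ (x + σ (σ x) + 1) = b * (x + σ (σ x) + 1) := by
    simp only [map_mul, map_add, map_one]
    generalize σ (σ (σ x)) = w at *
    generalize σ (σ x) = z at *
    generalize σ x = y at *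
    -- The two equations add up to `s ^ 2 v = (b + b) g = 0`.
    have hv : x * z * ((y + 1) * (w + 1)) + y * w * ((x + 1) * (z + 1)) = 0 := by
      have : (x + z) ^ 2 *
          (x * z * ((y + 1) * (w + 1)) + y * w * ((x + 1) * (z + 1))) = 0 := by grind
      simpa [hs] using this
    have hr : (x + 1) * (z + 1) ≠ 0 := right_ne_zero_of_mul hg
    have hp : x * z ≠ 0 := left_ne_zero_of_mul hg
    have hp' : y * w = b * (x * z) := by
      refine mul_right_cancel₀ hr ?_
      linear_combination (norm := skip) -e1 + (z + 1) ^ 2 * hv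
      clear * -
      grind
    have hr' : (y + 1) * (w + 1) = b * ((x + 1) * (z + 1)) := by
      refine mul_right_cancel₀ hp ?_
      linear_combination (norm := skip) -e1 + z ^ 2 * hv
      clear * -
      grind
    exact ⟨hp', by linear_combination hr' - hp'⟩
  refine ⟨?_, h1⟩
  have h2 := congrArg σ h1.1
  have h3 := h1.1
  simp only [map_mul, hσ] at h2 h3
  rw [h3] at h2
  refine mul_right_cancel₀ (left_ne_zero_of_mul hg) ?_
  linear_combination -h2

theorem isDerivSol_of_unit [CharP F 2] {b x : F}
    (h1 : σ (x * σ (σ x)) = b * (x * σ (σ x)))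
    (h2 : σ (x + σ (σ x) + 1) = b * (x + σ (σ x) + 1)) : IsDerivSol σ b x := by
  unfold IsDerivSol
  simp only [map_mul, map_add, map_one] at *
  generalize σ (σ (σ x)) = w at *
  generalize σ (σ x) = z at *
  generalize σ x = y at *
  linear_combination (norm := skip) (-(z * (x + 1) + (z + 1) * x)) * h1 - (z + 1) * x * h2
  clear * -
  grind

/-- Solutions `x` over some `b` outside the field of `q ^ 2` elements: `t ≠ 0`, and `x ^ 2` is
determined by `b` up to the choice of a root `U` of `U ^ 2 + U = k * σ k`. -/
theorem sq_eq_of_isDerivSol [CharP F 2] (hσ : ∀ x, σ (σ (σ (σ x))) = x) {b c t n k x : F}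
    (hx : σ (σ x) ≠ x)
    (hc : c = σ (σ b)) (hbc : b ≠ c) (h : IsDerivSol σ b x) (ht : t = b + c + σ (b + c))
    (hn : n = b * c + 1) (hk : k = σ n / t) :
    t ≠ 0 ∧ ∃ U, σ U = U + 1 ∧ U ^ 2 + U = k * σ k ∧ x ^ 2 = k * c + U := by
  obtain ⟨hg, hs⟩ := norm_ne_zero_of_not_fixed hx
  have hD := norm_add_norm_ne_zero hσ hx
  have h' := congrArg (fun u => σ (σ u)) h
  simp only [map_mul, map_add, map_one, hσ, ← hc] at h'
  have hg' : σ (x * σ (σ x) * ((x + 1) * (σ (σ x) + 1))) ≠ 0 := (map_ne_zero σ).2 hg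
  have e1 := deriv_mul_norm_eq h
  have e2 := deriv_mul_norm_eq h'
  have e4 : (b + c) * (x * σ (σ x) * ((x + 1) * (σ (σ x) + 1))) = (x + σ (σ x)) ^ 2 *
      (x * σ (σ x) * ((σ x + 1) * (σ (σ (σ x)) + 1)) +
        σ x * σ (σ (σ x)) * ((x + 1) * (σ (σ x) + 1))) := by
    linear_combination (norm := skip) e1 + e2
    clear * -
    grind
  have hx0 := left_ne_zero_of_mul hg
  have hx1 := right_ne_zero_of_mul hg
  have e3 := deriv_mul_conj_add_one (left_ne_zero_of_mul hx0) (left_ne_zero_of_mul hx1)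
    (right_ne_zero_of_mul hx0) (right_ne_zero_of_mul hx1) h h'
  have ht' : σ t = t := by simp only [ht, map_add, hc, hσ]; ring
  have hn' : σ (σ n) = n := by simp only [hn, map_add, map_mul, map_one, hc, hσ]; ring
  have hk' : σ k = n / t := by rw [hk, map_div₀, ht', hn']
  rw [← hn] at e3
  set y := σ x with hy
  set z := σ y with hz
  set w := σ z with hw
  have hσw : σ w = x := hσ x
  set v := x * z * ((y + 1) * (w + 1)) + y * w * ((x + 1) * (z + 1)) with hv
  set g := x * z * ((x + 1) * (z + 1)) with hgdef
  have hσv : σ v = v := by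
    simp only [hv, map_add, map_mul, map_one, ← hy, ← hz, ← hw, hσw]; ring
  have hσg : σ g = y * w * ((y + 1) * (w + 1)) := by
    simp only [hgdef, map_mul, map_add, map_one, ← hy, ← hw]
  have hσs : σ (x + z) = y + w := by simp only [map_add, ← hy, ← hw]
  have hσy : σ (y + w) = x + z := by rw [map_add, ← hz, hσw, add_comm]
  have hσσg : σ (σ g) = g := by
    rw [hσg, hgdef]; simp only [map_mul, map_add, map_one, ← hz, hσw]; ring
  rw [← hσg] at e3 hD
  have e3' := congrArg σ e3
  have e4' := congrArg σ e4
  simp only [map_mul σ n, map_mul σ (b + c), map_mul σ (_ ^ 2), map_add σ (_ * _), map_pow, hσs,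
    hσy, hσσg, hσv] at e3' e4'
  have hv0 : v ≠ 0 := by
    intro h0
    rw [h0, mul_zero] at e4
    have : b + c = 0 := by simpa [hg] using e4
    exact hbc (CharTwo.add_eq_zero.1 this)
  have htv : t * (g * σ g) = v * ((y + w) ^ 2 * g + (x + z) ^ 2 * σ g) := by
    rw [ht]; linear_combination σ g * e4 + g * e4'
  have ht0 : t ≠ 0 := by
    intro h0
    rw [h0, zero_mul] at htv
    exact mul_ne_zero hv0 hD htv.symm
  have hkg : k = g / v := by
    rw [hk, div_eq_div_iff ht0 hv0]
    refine mul_right_cancel₀ hg' ?_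
    linear_combination v * e3' - htv
  have hkg' : σ k = σ g / v := by rw [hkg, map_div₀, hσv]
  refine ⟨ht0, x * z * ((y + 1) * (w + 1)) / v, ?_, ?_, ?_⟩
  · rw [map_div₀, hσv]
    simp only [map_mul, map_add, map_one, ← hy, ← hz, ← hw, hσw]
    field_simp
    clear * -
    grind
  · rw [hkg', hkg, hσg]
    field_simp
    clear * -
    grind
  · rw [hkg]
    field_simp
    linear_combination (norm := skip) -e2
    clear * -
    grind

/-- The converse of `sq_eq_of_isDerivSol`. -/
theorem isDerivSol_of_sq_eq [CharP F 2] (hσ : ∀ x, σ (σ (σ (σ x))) = x) {b c t n k U x : F}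
    (hc : c = σ (σ b)) (ht0 : t ≠ 0) (ht : t = b + c + σ (b + c))
    (hn : n = b * c + 1) (hk : k = σ n / t) (hU : σ U = U + 1) (hU2 : U ^ 2 + U = k * σ k)
    (hx : x ^ 2 = k * c + U) : IsDerivSol σ b x := by
  have ht' : σ t = t := by simp only [ht, map_add, hc, hσ]; ring
  have hn' : σ (σ n) = n := by simp only [hn, map_add, map_mul, map_one, hc, hσ]; ring
  have hk' : σ k = n / t := by rw [hk, map_div₀, ht', hn']
  have hkk : σ (σ k) = k := by rw [hk', map_div₀, ht', hk]
  have hcc : σ (σ c) = b := by rw [hc, hσ]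
  have hU0 : U ≠ 0 := by rintro rfl; simp at hU
  have hU1 : U + 1 ≠ 0 := by rw [← hU]; simpa using hU0
  have y2 : (σ x) ^ 2 = σ k * σ c + U + 1 := by
    rw [← map_pow, hx, map_add, map_mul, hU]; ring
  have z2 : (σ (σ x)) ^ 2 = k * b + U := by
    rw [← map_pow, ← map_pow, hx, map_add, map_mul, hU, map_add, map_mul, hkk, hcc, map_add,
      map_one, hU]
    clear * -
    grind
  have w2 : (σ (σ (σ x))) ^ 2 = σ k * σ b + U + 1 := by
    rw [← map_pow, z2, map_add, map_mul, hU]; ring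
  have e1 : k * t = σ b * σ c + 1 := by
    rw [hk, hn, map_add, map_mul, map_one]; field_simp
  have e2 : σ k * t = b * c + 1 := by rw [hk', hn]; field_simp
  rw [map_add] at ht
  have i1 := conj_norm_mul_sq_eq e1 e2 ht hU2
  have i2 := conj_norm_mul_sq_eq (U := U + 1) e1 e2 ht (by rw [← hU2]; clear * -; grind)
  unfold IsDerivSol
  -- After squaring, everything is a polynomial in `X = x ^ 2, Y = y ^ 2, Z = z ^ 2, W = w ^ 2`.
  refine CharTwo.sq_injective ?_
  refine mul_right_cancel₀ (pow_ne_zero 2 (mul_ne_zero hU0 hU1)) ?_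
  generalize hX : k * c + U = X at *
  generalize hZ : k * b + U = Z at *
  generalize hY : σ k * σ c + U + 1 = Y at *
  generalize hW : σ k * σ b + U + 1 = W at *
  have j2 : (Y + 1) * (W + 1) * (U + 1) ^ 2 = σ k ^ 2 * ((X + 1) * (Z + 1)) := by
    rw [← hX, ← hY, ← hZ, ← hW]; linear_combination i2
  have hR : (σ x * σ (σ x) * σ (σ (σ x)) * (x + 1) +
      (σ x + 1) * (σ (σ x) + 1) * (σ (σ (σ x)) + 1) * x) ^ 2 =
      Y * Z * W * (X + 1) + (Y + 1) * (Z + 1) * (W + 1) * X := by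
    rw [← hx, ← y2, ← z2, ← w2]; clear * -; grind
  have hL : (b * (x * (x + 1))) ^ 2 = b ^ 2 * (X * (X + 1)) := by
    rw [← hx]; clear * -; grind
  have hUk : U * (U + 1) = k * σ k := by linear_combination hU2
  have hkb : k * b = Z + U := by rw [← hZ]; clear * -; grind
  simp only
  rw [hR, hL]
  have hl : b ^ 2 * (X * (X + 1)) * (U * (U + 1)) ^ 2 =
      X * (X + 1) * σ k ^ 2 * (Z + U) ^ 2 := by rw [hUk, ← hkb]; ring
  rw [hl]
  linear_combination (norm := skip) -(Z * (X + 1) * (U + 1) ^ 2) * i1 - (Z + 1) * X * U ^ 2 * j2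
  clear * -
  grind

end ringhom

/-! ### Parametrizing the fibre over a root of unity -/

section unit

variable {F : Type*} [Field F] {σ : F →+* F}

/-- The solution attached to a pair `(α, γ)`. Writing `γ = β + S * θ` with `S = γ + σ γ` (so that `β`
and `S` are fixed by `σ` when `θ + σ θ = 1` and `γ` is fixed by `σ²`), it is
`(1 + θ * S) * η + (α + θ * β)`. -/
def unitParam (σ : F →+* F) (θ η : F) (a : F × F) : F :=
  a.1 + η + θ * (a.2 + (a.2 + σ a.2) * θ + (a.2 + σ a.2) * η)

/-- The pairs `(α, γ)` with `α` fixed by `σ`, `γ` fixed by `σ²`, and `α ^ 2 + α = ν * (γ * σ γ)`. -/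
def normPairs (σ : F →+* F) (ν : F) : Set (F × F) :=
  {a | σ a.1 = a.1 ∧ σ (σ a.2) = a.2 ∧ a.1 ^ 2 + a.1 = ν * (a.2 * σ a.2)}

theorem unitParam_add_conj [CharP F 2] {b θ η : F} (hb1 : σ b * b = 1) (hθ : σ θ = b * θ)
    (hη : σ (σ η) = η + 1) {a : F × F} (h1 : σ a.1 = a.1) (h2 : σ (σ a.2) = a.2) :
    unitParam σ θ η a + σ (σ (unitParam σ θ η a)) = 1 + θ * (a.2 + σ a.2) := by
  have hθθ : σ (σ θ) = θ := by rw [hθ, map_mul, hθ]; linear_combination θ * hb1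
  simp only [unitParam, map_add, map_mul, h1, h2, hη, hθθ]
  generalize σ a.2 = e
  clear * -
  grind

/-- In the basis `1, θ` over the field of `q` elements, the norm of `unitParam σ θ η (α, γ)` has first
coordinate `α ^ 2 + α + ν * (γ * σ γ)`; as `σ θ = b * θ`, that coordinate measures the failure of
`σ p = b * p`. -/
theorem unitParam_norm [CharP F 2] {b θ η ν : F} (hb1 : σ b * b = 1) (hθ : σ θ = b * θ)
    (hθ1 : θ + σ θ = 1) (hν : ν = θ * σ θ)
    (hη : σ (σ η) = η + 1) (hη2 : η ^ 2 + η = θ * ν)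
    {a : F × F} (h1 : σ a.1 = a.1) (h2 : σ (σ a.2) = a.2) :
    σ (unitParam σ θ η a * σ (σ (unitParam σ θ η a))) +
      b * (unitParam σ θ η a * σ (σ (unitParam σ θ η a))) =
      (1 + b) * (a.1 ^ 2 + a.1 + ν * (a.2 * σ a.2)) := by
  have hx := unitParam_add_conj hb1 hθ hη h1 h2
  have hz : σ (σ (unitParam σ θ η a)) = unitParam σ θ η a + (1 + θ * (a.2 + σ a.2)) := by
    rw [← hx]; clear * -; grind
  have hθ2 : σ θ = θ + 1 := by rw [← hθ1]; clear * -; grind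
  have hνθ : ν = θ ^ 2 + θ := by rw [hν, hθ2]; ring
  have hS : σ (a.2 + σ a.2) = a.2 + σ a.2 := by rw [map_add, h2, add_comm]
  have hβ : σ (a.2 + (a.2 + σ a.2) * θ) = a.2 + (a.2 + σ a.2) * θ := by
    rw [map_add, map_mul, hS, hθ2]; clear * -; grind
  have hσν : σ ν = ν := by rw [hνθ, map_add, map_pow, hθ2]; clear * -; grind
  have hN : a.2 * σ a.2 = (a.2 + (a.2 + σ a.2) * θ) ^ 2 +
      (a.2 + σ a.2) * (a.2 + (a.2 + σ a.2) * θ) + ν * (a.2 + σ a.2) ^ 2 := by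
    rw [hνθ]; clear * -; grind
  rw [hz, unitParam, hN]
  generalize a.2 + (a.2 + σ a.2) * θ = β at *
  generalize a.2 + σ a.2 = S at *
  generalize a.1 = α at *
  have hp : (α + η + θ * (β + S * η)) * (α + η + θ * (β + S * η) + (1 + θ * S)) =
      α ^ 2 + α + ν * (β ^ 2 + S * β + ν * S ^ 2) +
        θ * (ν * (1 + ν * S ^ 2 + S ^ 2) + β + S * α + S * β + β ^ 2) := by
    have h3 : η ^ 2 = η + θ * ν := by rw [← hη2]; clear * -; grind
    have h4 : θ ^ 2 = θ + ν := by rw [hνθ]; clear * -; grind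
    clear * - h3 h4
    grind
  rw [hp]
  simp only [map_add, map_mul, map_pow, map_one, h1, hβ, hS, hσν, hθ]
  clear * -
  grind

/-- The fibre over a root of unity `b ≠ 1`. -/
theorem unit_fibre_eq_image [CharP F 2] (hσ : ∀ x, σ (σ (σ (σ x))) = x) {b θ η ν : F}
    (hb1 : σ b * b = 1)
    (hb : b ≠ 1) (hθ : σ θ = b * θ) (hθ1 : θ + σ θ = 1) (hν : ν = θ * σ θ)
    (hη : σ (σ η) = η + 1) (hη2 : η ^ 2 + η = θ * ν) :
    {x | σ (σ x) ≠ x ∧ IsDerivSol σ b x} = unitParam σ θ η '' normPairs σ ν := by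
  have hθ0 : θ ≠ 0 := by rintro rfl; simp at hθ1
  have hb0 : 1 + b ≠ 0 := fun h => hb (CharTwo.add_eq_zero.1 h).symm
  have hbb : σ (σ b) = b := by
    have h2 := congrArg σ hb1
    simp only [map_mul, map_one] at h2
    have : b * σ b ≠ 0 := by rw [mul_comm, hb1]; exact one_ne_zero
    refine mul_right_cancel₀ (right_ne_zero_of_mul this) ?_
    linear_combination h2 - hb1
  have hθ2 : σ θ = θ + 1 := by rw [← hθ1]; clear * -; grind
  have hθθ : σ (σ θ) = θ := by rw [hθ, map_mul, hθ]; linear_combination θ * hb1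
  ext x
  constructor
  · rintro ⟨hx, h⟩
    obtain ⟨-, hp, hs⟩ := unit_of_isDerivSol hσ hx hbb h
    have hσS : σ ((x + σ (σ x) + 1) / θ) = (x + σ (σ x) + 1) / θ := by
      have : b * θ ≠ 0 := by rw [← hθ]; simpa using hθ0
      rw [map_div₀, hs, hθ, div_eq_div_iff this hθ0]; ring
    have hS : θ * ((x + σ (σ x) + 1) / θ) = x + σ (σ x) + 1 := by field_simp
    generalize (x + σ (σ x) + 1) / θ = S at *
    have hz : σ (σ x) = x + 1 + θ * S := by rw [hS]; clear * -; grind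
    -- Since `x + σ² x = 1 + θ S`, the element `m` is fixed by `σ²`; decompose it as `α + θ β`.
    obtain ⟨m, hm⟩ : ∃ m, m = x + (1 + θ * S) * η := ⟨_, rfl⟩
    have hmm : σ (σ m) = m := by
      rw [hm]; simp only [map_add, map_mul, map_one, hz, hσS, hθθ, hη]; clear * -; grind
    refine ⟨(m + θ * (m + σ m), m + σ m + θ * S), ?_⟩
    have h1 : σ (m + θ * (m + σ m)) = m + θ * (m + σ m) := by
      simp only [map_add, map_mul, hmm, hθ2]; clear * -; grind
    have h2 : σ (σ (m + σ m + θ * S)) = m + σ m + θ * S := by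
      simp only [map_add, map_mul, hmm, hθθ, hσS]
    have hxx : unitParam σ θ η (m + θ * (m + σ m), m + σ m + θ * S) = x := by
      simp only [unitParam, map_add, map_mul, hmm, hσS, hθ2]
      generalize σ m = e
      rw [hm]
      clear * -
      grind
    refine ⟨⟨h1, h2, ?_⟩, hxx⟩
    have := unitParam_norm hb1 hθ hθ1 hν hη hη2 (a := (m + θ * (m + σ m), m + σ m + θ * S)) h1 h2
    rw [hxx, hp, CharTwo.add_self_eq_zero] at this
    exact CharTwo.add_eq_zero.1 ((mul_eq_zero.1 this.symm).resolve_left hb0)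
  · rintro ⟨a, ⟨h1, h2, h3⟩, rfl⟩
    have hs := unitParam_add_conj hb1 hθ hη h1 h2
    have hp := unitParam_norm hb1 hθ hθ1 hν hη hη2 h1 h2
    rw [← h3, CharTwo.add_self_eq_zero, mul_zero] at hp
    generalize unitParam σ θ η a = x at *
    have hσS : σ (a.2 + σ a.2) = a.2 + σ a.2 := by rw [map_add, h2, add_comm]
    generalize a.2 + σ a.2 = S at *
    have hs' : x + σ (σ x) + 1 = θ * S := by rw [hs]; clear * -; grind
    have hx : σ (σ x) ≠ x := by
      intro h
      rw [h, CharTwo.add_self_eq_zero, zero_add] at hs'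
      have := congrArg σ hs'
      rw [map_mul, map_one, hσS, hθ2] at this
      have hS0 : S = 0 := by linear_combination this.symm - hs'.symm
      rw [hS0, mul_zero] at hs'
      exact one_ne_zero hs'
    exact ⟨hx, isDerivSol_of_unit (CharTwo.add_eq_zero.1 hp) (by rw [hs', map_mul, hσS, hθ]; ring)⟩

theorem unitParam_injOn [CharP F 2] {b θ η ν : F} (hb1 : σ b * b = 1)
    (hθ : σ θ = b * θ) (hθ1 : θ + σ θ = 1) (hη : σ (σ η) = η + 1) :
    Set.InjOn (unitParam σ θ η) (normPairs σ ν) := by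
  have hθ0 : θ ≠ 0 := by rintro rfl; simp at hθ1
  have hθ2 : σ θ = θ + 1 := by rw [← hθ1]; clear * -; grind
  rintro ⟨α, γ⟩ ⟨h1, h2, -⟩ ⟨α', γ'⟩ ⟨h1', h2', -⟩ h
  have hs := unitParam_add_conj hb1 hθ hη h1 h2
  rw [h, unitParam_add_conj hb1 hθ hη h1' h2'] at hs
  simp only [unitParam] at *
  have hS : γ + σ γ = γ' + σ γ' := mul_left_cancel₀ hθ0 (by linear_combination -hs)
  rw [hS] at h
  have hm : α + θ * γ = α' + θ * γ' := by linear_combination h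
  have hm' := congrArg σ hm
  simp only [map_add, map_mul, h1, h1', hθ2] at hm'
  have hγ : γ = γ' := by
    clear * - hm hm' hS
    grind
  subst hγ
  rw [add_right_cancel hm]

end unit

/-! ### The absolute trace in characteristic two -/

section trace

variable {F : Type*} [Field F]

theorem finTrace_two_add [CharP F 2] (m : ℕ) (x y : F) :
    finTrace 2 m (x + y) = finTrace 2 m x + finTrace 2 m y := by
  simp only [finTrace, add_pow_char_pow, Finset.sum_add_distrib]

theorem finTrace_two_sq [CharP F 2] (m : ℕ) (x : F) : finTrace 2 m
    (x ^ 2) = finTrace 2 m x ^ 2 := by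
  simp only [finTrace, CharTwo.sum_sq, ← pow_mul, mul_comm]

/-- The trace of `x ^ 2 + x` telescopes. -/
theorem finTrace_two_sq_add [CharP F 2] (m : ℕ) (x : F) : finTrace 2 m
    (x ^ 2 + x) = x ^ 2 ^ m + x := by
  induction m with
  | zero => simp [finTrace, CharTwo.add_self_eq_zero]
  | succ m ih =>
    have h : finTrace 2 (m + 1) (x ^ 2 + x) = finTrace 2 m (x ^ 2 + x) + (x ^ 2 + x) ^ 2 ^ m :=
      Finset.sum_range_succ _ _
    rw [h, ih, add_pow_char_pow, ← pow_mul, ← pow_succ']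
    generalize x ^ 2 ^ m = y
    clear * -
    grind

theorem finTrace_two_double (m : ℕ) (x : F) :
    finTrace 2 (m + m) x = finTrace 2 m x + finTrace 2 m (x ^ 2 ^ m) := by
  simp only [finTrace, Finset.sum_range_add, ← pow_mul, ← pow_add]

/-- The additive form of Hilbert's Theorem 90: the image of `y ↦ y ^ 2 + y` has at least
`2 ^ (m - 1)` elements and lies in the zero set of the trace, a polynomial of degree
`2 ^ (m - 1)`. -/
theorem exists_sq_add_eq_of_finTrace_eq_zero [CharP F 2] [Finite F] {m : ℕ}
    (hF : Nat.card F = 2 ^ m)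
    (a : F) (ha : finTrace 2 m a = 0) : ∃ y, y ^ 2 + y = a := by
  classical
  have := Fintype.ofFinite F
  rw [Nat.card_eq_fintype_card] at hF
  have hm : m ≠ 0 := by
    rintro rfl
    have := Fintype.one_lt_card (α := F)
    omega
  obtain ⟨k, rfl⟩ := Nat.exists_eq_succ_of_ne_zero hm
  let P : Polynomial F := ∑ i ∈ Finset.range (k + 1), Polynomial.X ^ 2 ^ i
  have hP0 : P ≠ 0 := by
    intro h
    have h1 : P.coeff 1 = 1 := by
      simp only [P, Polynomial.finsetSum_coeff, Polynomial.coeff_X_pow]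
      rw [Finset.sum_eq_single 0]
      · simp
      · intro i _ hi
        rw [if_neg (Nat.one_lt_two_pow hi).ne]
      · simp
    simp [h] at h1
  have hdeg : P.natDegree ≤ 2 ^ k := by
    refine Polynomial.natDegree_sum_le_of_forall_le _ _ fun i hi => ?_
    rw [Polynomial.natDegree_X_pow]
    exact Nat.pow_le_pow_right (by norm_num) (Nat.lt_succ_iff.1 (Finset.mem_range.1 hi))
  have hsub : Finset.univ.image (fun y : F => y ^ 2 + y) ⊆ P.roots.toFinset := by
    intro c hc
    obtain ⟨y, -, rfl⟩ := Finset.mem_image.1 hc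
    rw [Multiset.mem_toFinset, Polynomial.mem_roots hP0, Polynomial.IsRoot.def]
    have : P.eval (y ^ 2 + y) = finTrace 2 (k + 1) (y ^ 2 + y) := by
      simp [P, finTrace, Polynomial.eval_finsetSum]
    rw [this, finTrace_two_sq_add, ← Nat.succ_eq_add_one, ← hF, FiniteField.pow_card,
      CharTwo.add_self_eq_zero]
  have hcard : P.roots.toFinset.card ≤ (Finset.univ.image (fun y : F => y ^ 2 + y)).card := by
    have h1 : P.roots.toFinset.card ≤ 2 ^ k :=
      (Multiset.toFinset_card_le _).trans ((Polynomial.card_roots' P).trans hdeg)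
    have h2 : (Finset.univ : Finset F).card ≤
        2 * (Finset.univ.image (fun y : F => y ^ 2 + y)).card := by
      refine Finset.card_le_mul_card_image _ 2 fun c hc => ?_
      obtain ⟨y, -, rfl⟩ := Finset.mem_image.1 hc
      refine (Finset.card_le_card (t := {y, y + 1}) fun x hx => ?_).trans Finset.card_le_two
      have hx' : x ^ 2 + x = y ^ 2 + y := (Finset.mem_filter.1 hx).2
      have : (x + y) * (x + y + 1) = 0 := by clear * - hx'; grind
      rw [Finset.mem_insert, Finset.mem_singleton]
      rcases mul_eq_zero.1 this with h | h
      · left; exact CharTwo.add_eq_zero.1 h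
      · right; clear * - h; grind
    rw [Finset.card_univ, hF, pow_succ] at h2
    omega
  have heq := Finset.eq_of_subset_of_card_le hsub hcard
  have hmem : a ∈ P.roots.toFinset := by
    rw [Multiset.mem_toFinset, Polynomial.mem_roots hP0, Polynomial.IsRoot.def]
    simpa [P, finTrace, Polynomial.eval_finsetSum] using ha
  rw [← heq] at hmem
  obtain ⟨y, -, hy⟩ := Finset.mem_image.1 hmem
  exact ⟨y, hy⟩

theorem exists_sq_add_eq_of_pow_eq [CharP F 2] [Finite F] {m : ℕ} (hF : Nat.card F = 2 ^ (m + m))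
    (a : F) (ha : a ^ 2 ^ m = a) : ∃ y, y ^ 2 + y = a :=
  exists_sq_add_eq_of_finTrace_eq_zero hF a (by
    rw [finTrace_two_double, ha, CharTwo.add_self_eq_zero])

end trace

/-! ### Counting roots of unity and norms -/

section roots

variable {F : Type*} [Field F] [Finite F]

theorem exists_isPrimitiveRoot {j : ℕ} (hj : j ∣ Nat.card F - 1) :
    ∃ ζ : F, IsPrimitiveRoot ζ j := by
  obtain ⟨g, hg⟩ := IsCyclic.exists_ofOrder_eq_natCard (α := Fˣ)
  obtain ⟨k, hk⟩ := hj
  have h0 : 0 < Nat.card Fˣ := Nat.card_pos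
  rw [Nat.card_units] at hg h0
  have hp : IsPrimitiveRoot (g : F) (Nat.card F - 1) := by
    rw [IsPrimitiveRoot.coe_units_iff, ← hg]; exact IsPrimitiveRoot.orderOf g
  exact ⟨_, hp.pow h0 (by rw [hk, mul_comm])⟩

theorem ncard_pow_eq {j : ℕ} (hj0 : 0 < j) (hj : j ∣ Nat.card F - 1) {a c : F} (ha : a ≠ 0)
    (hc : c ^ j = a) : {x : F | x ^ j = a}.ncard = j := by
  classical
  obtain ⟨ζ, hζ⟩ := exists_isPrimitiveRoot hj
  have h1 := hζ.card_nthRoots a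
  rw [if_pos ⟨c, hc⟩] at h1
  have h2 : {x : F | x ^ j = a} = ((Polynomial.nthRoots j a).toFinset : Set F) := by
    ext x; simp [Polynomial.mem_nthRoots hj0]
  rw [h2, Set.ncard_coe_finset, Multiset.toFinset_card_of_nodup (hζ.nthRoots_nodup ha), h1]

theorem ncard_pow_eq_one {j : ℕ} (hj0 : 0 < j) (hj : j ∣ Nat.card F - 1) :
    {x : F | x ^ j = 1}.ncard = j :=
  ncard_pow_eq hj0 hj one_ne_zero (one_pow j)

theorem ncard_pow_eq_self {j : ℕ} (hj0 : 0 < j) (hj : j ∣ Nat.card F - 1) :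
    {x : F | x ^ (j + 1) = x}.ncard = j + 1 := by
  have : {x : F | x ^ (j + 1) = x} = insert 0 {x : F | x ^ j = 1} := by
    ext x
    simp only [Set.mem_ofPred_eq, Set.mem_insert_iff]
    constructor
    · intro h
      by_cases hx : x = 0
      · exact Or.inl hx
      · exact Or.inr (mul_right_cancel₀ hx (by rw [one_mul, ← pow_succ, h]))
    · rintro (rfl | h)
      · simp
      · rw [pow_succ, h, one_mul]
  rw [this, Set.ncard_insert_of_notMem (by simp [hj0.ne']), ncard_pow_eq_one hj0 hj]

end roots

theorem dvd_card_sub_one {F : Type*} {q : ℕ} (hF : Nat.card F = q ^ 4) (hq : 1 ≤ q) :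
    (q - 1) * (q + 1) ∣ Nat.card F - 1 := by
  obtain ⟨r, rfl⟩ := Nat.exists_eq_add_of_le' hq
  refine ⟨(r + 1) ^ 2 + 1, ?_⟩
  rw [hF, Nat.sub_eq_iff_eq_add (Nat.one_le_pow _ _ hq)]
  simp only [Nat.add_sub_cancel]
  ring

section count

variable {F : Type*} [Field F] [Finite F] {σ : F →+* F} {q : ℕ}

theorem ncard_fixed (hσ : ∀ x, σ x = x ^ q) (hF : Nat.card F = q ^ 4) (hq : 2 ≤ q) :
    {x : F | σ x = x}.ncard = q := by
  obtain ⟨r, rfl⟩ := Nat.exists_eq_add_of_le' (by omega : 1 ≤ q)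
  simp only [hσ]
  exact ncard_pow_eq_self (by omega) ((Dvd.intro _ rfl).trans (dvd_card_sub_one hF (by omega)))

theorem ncard_fixed_sq (hσ : ∀ x, σ x = x ^ q) (hF : Nat.card F = q ^ 4) (hq : 2 ≤ q) :
    {x : F | σ (σ x) = x}.ncard = q ^ 2 := by
  have h := dvd_card_sub_one hF (by omega)
  have hj : q ^ 2 = (q - 1) * (q + 1) + 1 := by
    obtain ⟨r, rfl⟩ := Nat.exists_eq_add_of_le' (by omega : 1 ≤ q)
    simp only [Nat.add_sub_cancel]; ring
  simp only [hσ, ← pow_mul, ← pow_two, hj]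
  exact ncard_pow_eq_self (by apply Nat.mul_pos <;> omega) h

theorem ncard_norm_fibre (hσ : ∀ x, σ x = x ^ q) (hF : Nat.card F = q ^ 4) (hq : 2 ≤ q) {v : F}
    (hv0 : v ≠ 0) (hv : σ v = v) : {γ : F | γ * σ γ = v}.ncard = q + 1 := by
  have h := dvd_card_sub_one hF (by omega)
  have hpos : 0 < (q - 1) * (q + 1) := by apply Nat.mul_pos <;> omega
  -- `ξ` has order `q ^ 2 - 1`, so the powers of `ξ ^ (q + 1)` are all the `v ≠ 0` fixed by `σ`.
  obtain ⟨ξ, hξ⟩ := exists_isPrimitiveRoot (F := F) h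
  have hξ' := hξ.pow hpos (mul_comm _ _)
  have hv1 : v ^ (q - 1) = 1 := by
    refine mul_right_cancel₀ hv0 ?_
    rw [one_mul, ← pow_succ, Nat.sub_add_cancel (by omega), ← hσ, hv]
  have : NeZero (q - 1) := ⟨by omega⟩
  obtain ⟨i, -, hi⟩ := hξ'.eq_pow_of_pow_eq_one hv1
  simp only [hσ, ← pow_succ']
  exact ncard_pow_eq (by omega) ((Dvd.intro_left _ rfl).trans h) hv0
    (c := ξ ^ i) (by rw [← hi, ← pow_mul, ← pow_mul, mul_comm])

/-- For `α = 0, 1` only `γ = 0` is possible; each of the other `q - 2` values of `α` admits `q + 1`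
values of `γ`. -/
theorem ncard_normPairs [CharP F 2] (hσ : ∀ x, σ x = x ^ q) (hF : Nat.card F = q ^ 4) (hq : 2 ≤ q)
    {ν : F} (hν0 : ν ≠ 0) (hν : σ ν = ν) : (normPairs σ ν).ncard = q ^ 2 - q := by
  classical
  have := Fintype.ofFinite F
  set S : Finset F := Finset.univ.filter fun x => σ x = x with hS
  have hScard : S.card = q := by
    rw [← ncard_fixed hσ hF hq, ← Set.ncard_coe_finset]
    congr 1; ext x; simp [hS]
  have hfix : ∀ {v γ : F}, σ v = v → γ * σ γ = v → σ (σ γ) = γ := by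
    intro v γ hv h
    by_cases hγ : γ = 0
    · simp [hγ]
    · have h' := congrArg σ h
      rw [map_mul, hv, ← h] at h'
      exact mul_left_cancel₀ ((map_ne_zero σ).2 hγ) (by rw [h', mul_comm])
  have hA : normPairs σ ν = (S.sigma fun α =>
      Finset.univ.filter fun γ => γ * σ γ = (α ^ 2 + α) / ν).map
        (Equiv.sigmaEquivProd F F).toEmbedding := by
    ext ⟨α, γ⟩
    simp only [normPairs, Set.mem_ofPred_eq, Finset.coe_map, Set.mem_image, Finset.mem_coe,
      Finset.mem_sigma, Finset.mem_filter, Finset.mem_univ, true_and, hS, Sigma.exists,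
      Equiv.coe_toEmbedding, Equiv.sigmaEquivProd_apply, Prod.mk.injEq]
    constructor
    · rintro ⟨h1, h2, h3⟩
      exact ⟨α, γ, ⟨h1, by rw [h3]; field_simp⟩, rfl, rfl⟩
    · rintro ⟨α, γ, ⟨h1, h2⟩, rfl, rfl⟩
      refine ⟨h1, hfix (v := (α ^ 2 + α) / ν) ?_ h2, by rw [h2]; field_simp⟩
      rw [map_div₀, map_add, map_pow, h1, hν]
  rw [hA, Set.ncard_coe_finset, Finset.card_map, Finset.card_sigma]
  have hsub : ({0, 1} : Finset F) ⊆ S := by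
    intro x hx
    rcases Finset.mem_insert.1 hx with rfl | hx
    · simp [hS]
    · rw [Finset.mem_singleton.1 hx]; simp [hS]
  have hncard : ∀ v : F, (Finset.univ.filter fun γ => γ * σ γ = v).card =
      {γ : F | γ * σ γ = v}.ncard := by
    intro v
    rw [← Set.ncard_coe_finset]; congr 1; ext; simp
  rw [← Finset.sum_sdiff hsub, Finset.sum_const_nat (m := q + 1), Finset.sum_const_nat (m := 1),
    Finset.card_sdiff_of_subset hsub, hScard, Finset.card_pair zero_ne_one]
  · obtain ⟨r, rfl⟩ := Nat.exists_eq_add_of_le' hq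
    rw [Nat.add_sub_cancel]
    symm
    rw [Nat.sub_eq_iff_eq_add (by nlinarith)]
    ring
  · intro α hα
    have : (α ^ 2 + α) / ν = 0 := by
      rcases Finset.mem_insert.1 hα with rfl | hα
      · simp
      · rw [Finset.mem_singleton.1 hα]; simp [CharTwo.add_self_eq_zero]
    rw [this, Finset.card_eq_one]
    exact ⟨0, by ext; simp⟩
  · intro α hα
    obtain ⟨h1, h2⟩ := Finset.mem_sdiff.1 hα
    have h1 : σ α = α := (Finset.mem_filter.1 h1).2
    rw [hncard]
    refine ncard_norm_fibre hσ hF hq (div_ne_zero ?_ hν0) ?_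
    · intro h
      apply h2
      have : α * (α + 1) = 0 := by linear_combination h
      rcases mul_eq_zero.1 this with h | h
      · simp [h]
      · simp [CharTwo.add_eq_zero.1 h]
    · rw [map_div₀, map_add, map_pow, h1, hν]

end count

/-! ### The fibres of the derivative -/

section derivative

variable {F : Type*} [Field F] {σ : F →+* F} {n q d : ℕ}

theorem isDerivSol_iff (hσ : ∀ x, σ x = x ^ q) (hq : 2 ≤ q) (hd : d = q ^ 3 + q ^ 2 + q - 1)
    {b x : F} (h0 : x ≠ 0) (h1 : x + 1 ≠ 0) : x ^ d + (x + 1) ^ d = b ↔ IsDerivSol σ b x := by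
  have hp : ∀ u : F, u * u ^ d = σ u * σ (σ u) * σ (σ (σ u)) := by
    intro u
    have : d + 1 = q + q * q + q * q * q := by
      rw [hd, Nat.sub_add_cancel (by omega)]; ring
    rw [← pow_succ', this]
    simp only [hσ, ← pow_mul, ← pow_add]
  have hp1 := hp (x + 1)
  simp only [map_add, map_one] at hp1
  unfold IsDerivSol
  rw [← hp, ← hp1]
  constructor
  · rintro rfl; ring
  · intro h
    refine mul_right_cancel₀ (mul_ne_zero h0 h1) ?_
    rw [h]; ring

theorem deriv_eq_one_of_mem [CharP F 2] (hq : 2 ≤ q) (hd : d = q ^ 3 + q ^ 2 + q - 1) {x : F}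
    (hx : x = 0 ∨ x + 1 = 0) : x ^ d + (x + 1) ^ d = 1 := by
  have hd0 : d ≠ 0 := by omega
  rcases hx with rfl | hx
  · simp [hd0]
  · rw [hx, CharTwo.add_eq_zero.1 hx]; simp [hd0]

theorem deriv_fibre_one [CharP F 2] (hσ : ∀ x, σ x = x ^ q) (hσ4 : ∀ x, σ (σ (σ (σ x))) = x)
    (hq : 2 ≤ q) (hd : d = q ^ 3 + q ^ 2 + q - 1) :
    {x : F | x ^ d + (x + 1) ^ d = 1} = {x | σ (σ x) = x} := by
  ext x
  rw [Set.mem_ofPred_eq, Set.mem_ofPred_eq]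
  by_cases hx : x = 0 ∨ x + 1 = 0
  · rw [iff_true_left (deriv_eq_one_of_mem hq hd hx)]
    rcases hx with rfl | hx
    · simp
    · rw [CharTwo.add_eq_zero.1 hx]; simp
  · rw [not_or] at hx
    rw [isDerivSol_iff hσ hq hd hx.1 hx.2, isDerivSol_one_iff hσ4]

theorem deriv_fibre_of_ne_one [CharP F 2] (hσ : ∀ x, σ x = x ^ q) (hσ4 : ∀ x, σ (σ (σ (σ x))) = x)
    (hq : 2 ≤ q) (hd : d = q ^ 3 + q ^ 2 + q - 1) {b : F} (hb : b ≠ 1) :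
    {x : F | x ^ d + (x + 1) ^ d = b} = {x | σ (σ x) ≠ x ∧ IsDerivSol σ b x} := by
  ext x
  have h1 : x ^ d + (x + 1) ^ d = 1 ↔ σ (σ x) = x := Set.ext_iff.1 (deriv_fibre_one hσ hσ4 hq hd) x
  simp only [Set.mem_ofPred_eq]
  by_cases hx : x = 0 ∨ x + 1 = 0
  · have h := deriv_eq_one_of_mem hq hd hx
    simp only [h, Ne, h1.1 h, not_true, false_and, iff_false]
    exact hb.symm
  · rw [not_or] at hx
    rw [← isDerivSol_iff hσ hq hd hx.1 hx.2]
    refine ⟨fun h => ⟨fun h' => hb ?_, h⟩, fun h => h.2⟩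
    rw [← h, h1.2 h']

theorem ncard_deriv_fibre_one [Finite F] [CharP F 2] (hσ : ∀ x, σ x = x ^ q)
    (hσ4 : ∀ x, σ (σ (σ (σ x))) = x)
    (hF : Nat.card F = q ^ 4) (hq : 2 ≤ q) (hd : d = q ^ 3 + q ^ 2 + q - 1) :
    {x : F | x ^ d + (x + 1) ^ d = 1}.ncard = q ^ 2 := by
  rw [deriv_fibre_one hσ hσ4 hq hd, ncard_fixed_sq hσ hF hq]

theorem mem_rootsSet_iff (hσ : ∀ x, σ x = x ^ q) {b : F} :
    b ∈ rootsSet F (q + 1) ↔ σ b * b = 1 := by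
  rw [hσ, ← pow_succ]
  refine ⟨fun h => h.2, fun h => ⟨?_, h⟩⟩
  rintro rfl
  simp at h

theorem ncard_deriv_fibre_unit [Finite F] [CharP F 2] (hσ : ∀ x, σ x = x ^ q)
    (hσ4 : ∀ x, σ (σ (σ (σ x))) = x) (hqn : q = 2 ^ n)
    (hF : Nat.card F = q ^ 4) (hq : 2 ≤ q) (hd : d = q ^ 3 + q ^ 2 + q - 1) {b : F}
    (hb : b ∈ rootsSet F (q + 1) \ {1}) :
    {x : F | x ^ d + (x + 1) ^ d = b}.ncard = q ^ 2 - q := by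
  have hb1 : b ≠ 1 := hb.2
  have hbu : σ b * b = 1 := (mem_rootsSet_iff hσ).1 hb.1
  have hb0 : b + 1 ≠ 0 := fun h => hb1 (CharTwo.add_eq_zero.1 h)
  -- Hilbert 90 made explicit: `θ = (b + 1)⁻¹` satisfies `σ θ = b * θ`, and has trace `1`.
  obtain ⟨θ, hθdef⟩ : ∃ θ, θ = (b + 1)⁻¹ := ⟨_, rfl⟩
  have hσb0 : σ b + 1 ≠ 0 := by
    have := (map_ne_zero σ).2 hb0
    rwa [map_add, map_one] at this
  have hθ : σ θ = b * θ := by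
    rw [hθdef, map_inv₀, map_add, map_one]
    field_simp
    linear_combination -hbu
  have hθ1 : θ + σ θ = 1 := by
    rw [hθ, hθdef]; field_simp; ring
  have hθ0 : θ ≠ 0 := by rw [hθdef]; exact inv_ne_zero hb0
  have hθ2 : σ θ = θ + 1 := by rw [← hθ1]; clear * -; grind
  have hθθ : σ (σ θ) = θ := by rw [hθ2, map_add, hθ2, map_one]; clear * -; grind
  obtain ⟨ν, hν⟩ : ∃ ν, ν = θ * σ θ := ⟨_, rfl⟩
  have hν0 : ν ≠ 0 := by rw [hν]; exact mul_ne_zero hθ0 ((map_ne_zero σ).2 hθ0)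
  have hσν : σ ν = ν := by rw [hν, map_mul, hθθ, mul_comm]
  have hpow : ∀ x : F, x ^ 2 ^ (n + n) = σ (σ x) := by
    intro x; rw [hσ, hσ, hqn, ← pow_mul, ← pow_add]
  have hFn : Nat.card F = 2 ^ ((n + n) + (n + n)) := by rw [hF, hqn, ← pow_mul]; congr 1; ring
  obtain ⟨η, hη2⟩ := exists_sq_add_eq_of_pow_eq hFn (θ * ν)
    (by rw [hpow, map_mul, map_mul, hθθ, hσν, hσν])
  -- The trace of `θ ν` over the field of `q ^ 2` elements is that of `ν (θ + σ θ) = θ ^ 2 + θ` over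
  -- the field of `q` elements, which telescopes to `σ θ + θ = 1`.
  have hη : σ (σ η) = η + 1 := by
    have h1 := finTrace_two_sq_add (n + n) η
    have h2 : finTrace 2 n (θ * ν) + finTrace 2 n (σ (θ * ν)) = 1 := by
      rw [← finTrace_two_add, map_mul, hσν, ← add_mul, hθ1, one_mul]
      have : ν = θ ^ 2 + θ := by rw [hν, hθ2]; ring
      rw [this, finTrace_two_sq_add, ← hqn, ← hσ, add_comm, hθ1]
    rw [hη2, finTrace_two_double, ← hqn, ← hσ, h2, hpow] at h1
    rw [h1]; clear * -; grind
  rw [deriv_fibre_of_ne_one hσ hσ4 hq hd hb1,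
    unit_fibre_eq_image hσ4 hbu hb1 hθ hθ1 hν hη hη2,
    (unitParam_injOn hbu hθ hθ1 hη).ncard_image, ncard_normPairs hσ hF hq hν0 hσν]

/-- The trace condition defining `Λ` says that `U ^ 2 + U = k * σ k` has a root `U` with
`σ U = U + 1`: the right-hand side is the square of the element in that condition. -/
theorem mem_Lambda_iff [Finite F] [CharP F 2] (hσ : ∀ x, σ x = x ^ q)
    (hσ4 : ∀ x, σ (σ (σ (σ x))) = x)
    (hn : 1 ≤ n) (hqn : q = 2 ^ n) (hF : Nat.card F = q ^ 4) {b c t m k : F}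
    (hc : c = σ (σ b)) (ht : t = b + c + σ (b + c)) (hm : m = b * c + 1) (hk : k = σ m / t) :
    b ∈ Lambda F n q ↔ t ≠ 0 ∧ ∃ U, σ U = U + 1 ∧ U ^ 2 + U = k * σ k := by
  have ht' : σ t = t := by simp only [ht, map_add, hc, hσ4]; ring
  have hm' : σ (σ m) = m := by simp only [hm, map_add, map_mul, map_one, hc, hσ4]; ring
  have hk' : σ k = m / t := by rw [hk, map_div₀, ht', hm']
  have htr : finTrace (q ^ 2) 2 b = b + c := by
    simp [finTrace, Finset.sum_range_succ, hc, hσ, ← pow_mul, pow_two]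
  have hnm : finNorm (q ^ 2) 2 b + 1 = m := by
    simp [finNorm, Finset.prod_range_succ, hm, hc, hσ, ← pow_mul, pow_two]
  have hsq : halfPower q m ^ 2 = m := (sq_eq_iff_eq_halfPower hn hqn hF _ _).2 rfl
  have hκ : (halfPower q m ^ (q + 1) / t) ^ 2 = k * σ k := by
    rw [div_pow, ← pow_mul, mul_comm, pow_mul, hsq, hk', hk, hσ m, pow_succ]
    ring
  rw [Lambda, Set.mem_ofPred_eq, htr, hnm, ← hσ, ← ht]
  have hb0 : t ≠ 0 → b ≠ 0 := by
    rintro h rfl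
    exact h (by simp [ht, hc])
  have hT : finTrace 2 n (halfPower q m ^ (q + 1) / t) = 1 ↔ finTrace 2 n (k * σ k) = 1 := by
    rw [← hκ, finTrace_two_sq]
    constructor
    · intro h; rw [h, one_pow]
    · intro h; exact CharTwo.sq_injective (by simpa using h)
  rw [hT]
  constructor
  · rintro ⟨-, h1, h2⟩
    refine ⟨h1, ?_⟩
    have hFn : Nat.card F = 2 ^ ((n + n) + (n + n)) := by rw [hF, hqn, ← pow_mul]; congr 1; ring
    obtain ⟨U, hU⟩ := exists_sq_add_eq_of_pow_eq hFn (k * σ k) (by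
      have : ∀ x : F, x ^ 2 ^ (n + n) = σ (σ x) := by
        intro x; rw [hσ, hσ, hqn, ← pow_mul, ← pow_add]
      have hkk : σ (σ k) = k := by rw [hk', map_div₀, ht', hk]
      rw [this, map_mul, map_mul, hkk])
    refine ⟨U, ?_, hU⟩
    rw [← hU, finTrace_two_sq_add, ← hqn, ← hσ] at h2
    rw [← h2]; clear * -; grind
  · rintro ⟨h1, U, hU, hU2⟩
    refine ⟨hb0 h1, h1, ?_⟩
    rw [← hU2, finTrace_two_sq_add, ← hqn, ← hσ, hU]
    clear * -; grind

theorem ncard_deriv_fibre_Lambda [Finite F] [CharP F 2] (hσ : ∀ x, σ x = x ^ q)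
    (hσ4 : ∀ x, σ (σ (σ (σ x))) = x)
    (hn : 1 ≤ n) (hqn : q = 2 ^ n)
    (hF : Nat.card F = q ^ 4) (hq : 2 ≤ q) (hd : d = q ^ 3 + q ^ 2 + q - 1) {b : F}
    (hb : b ∈ Lambda F n q) :
    {x : F | x ^ d + (x + 1) ^ d = b}.ncard = 2 := by
  obtain ⟨c, hc⟩ : ∃ c, c = σ (σ b) := ⟨_, rfl⟩
  obtain ⟨t, ht⟩ : ∃ t, t = b + c + σ (b + c) := ⟨_, rfl⟩
  obtain ⟨m, hm⟩ : ∃ m, m = b * c + 1 := ⟨_, rfl⟩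
  obtain ⟨k, hk⟩ : ∃ k, k = σ m / t := ⟨_, rfl⟩
  obtain ⟨ht0, U, hU, hU2⟩ := (mem_Lambda_iff hσ hσ4 hn hqn hF hc ht hm hk).1 hb
  have hbc : b ≠ c := by
    intro h
    apply ht0
    rw [ht, ← h, CharTwo.add_self_eq_zero, map_zero, add_zero]
  have hb1 : b ≠ 1 := by
    rintro rfl
    exact hbc (by simp [hc])
  have hx : halfPower q (k * c + U) ^ 2 = k * c + U :=
    (sq_eq_iff_eq_halfPower hn hqn hF _ _).2 rfl
  generalize halfPower q (k * c + U) = x at hx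
  have hsol := isDerivSol_of_sq_eq hσ4 hc ht0 ht hm hk hU hU2 hx
  have hk0 : k ≠ 0 := by
    rintro h0
    have h1 : U * σ U = 0 := by rw [hU]; linear_combination hU2 + σ k * h0
    have hU0 : U ≠ 0 := by rintro rfl; simp at hU
    exact mul_ne_zero hU0 ((map_ne_zero σ).2 hU0) h1
  have hxF : σ (σ x) ≠ x := by
    intro h
    have h1 : σ (σ (x ^ 2)) = x ^ 2 := by rw [map_pow, map_pow, h]
    have hkk : σ (σ k) = k := by
      rw [hk, ht, hm, hc]
      simp only [map_div₀, map_add, map_mul, map_one, hσ4]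
      congr 1 <;> ring
    have hUU : σ (σ U) = U := by rw [hU, map_add, hU, map_one]; clear * -; grind
    have hcc : σ (σ c) = b := by rw [hc, hσ4]
    simp only [hx, map_add, map_mul, hkk, hUU, hcc] at h1
    exact hbc (mul_left_cancel₀ hk0 (add_right_cancel h1))
  have : {x : F | x ^ d + (x + 1) ^ d = b} = {x, x + 1} := by
    rw [deriv_fibre_of_ne_one hσ hσ4 hq hd hb1]
    ext y
    simp only [Set.mem_ofPred_eq, Set.mem_insert_iff, Set.mem_singleton_iff]
    constructor
    · rintro ⟨hy, h⟩
      obtain ⟨-, V, hV, hV2, hyV⟩ := sq_eq_of_isDerivSol hσ4 hy hc hbc h ht hm hk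
      have h1 : (V + U) * (V + U + 1) = 0 := by
        rw [← hU2] at hV2; clear * - hV2; grind
      rcases mul_eq_zero.1 h1 with h1 | h1
      · left
        refine CharTwo.sq_injective ?_
        simp only
        rw [hyV, hx, CharTwo.add_eq_zero.1 h1]
      · right
        refine CharTwo.sq_injective ?_
        simp only
        rw [hyV, CharTwo.add_sq, hx]
        clear * - h1
        grind
    · rintro (rfl | rfl)
      · exact ⟨hxF, hsol⟩
      · exact ⟨by simpa using hxF, isDerivSol_add_one hsol⟩
  rw [this, Set.ncard_pair]
  intro h
  simpa using h.symm

/-- The values of the derivative other than `1` lie in the two listed sets. -/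
theorem mem_rootsSet_or_mem_Lambda [Finite F] [CharP F 2] (hσ : ∀ x, σ x = x ^ q)
    (hσ4 : ∀ x, σ (σ (σ (σ x))) = x)
    (hn : 1 ≤ n) (hqn : q = 2 ^ n)
    (hF : Nat.card F = q ^ 4) (hq : 2 ≤ q) (hd : d = q ^ 3 + q ^ 2 + q - 1) {b x : F}
    (hb1 : b ≠ 1) (hx : x ^ d + (x + 1) ^ d = b) :
    b ∈ rootsSet F (q + 1) ∨ b ∈ Lambda F n q := by
  have h : x ∈ {x | σ (σ x) ≠ x ∧ IsDerivSol σ b x} := by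
    rw [← deriv_fibre_of_ne_one hσ hσ4 hq hd hb1]; exact hx
  by_cases hbb : σ (σ b) = b
  · left
    exact (mem_rootsSet_iff hσ).2 (unit_of_isDerivSol hσ4 h.1 hbb h.2).1
  · right
    obtain ⟨h1, U, h2, h3, -⟩ := sq_eq_of_isDerivSol hσ4 h.1 rfl (Ne.symm hbb) h.2 rfl rfl rfl
    exact (mem_Lambda_iff hσ hσ4 hn hqn hF rfl rfl rfl rfl).2 ⟨h1, U, h2, h3⟩

theorem not_mem_Lambda_of_fixed [Finite F] [CharP F 2] (hσ : ∀ x, σ x = x ^ q)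
    (hσ4 : ∀ x, σ (σ (σ (σ x))) = x)
    (hn : 1 ≤ n) (hqn : q = 2 ^ n) (hF : Nat.card F = q ^ 4) {b : F} (hb : σ (σ b) = b) :
    b ∉ Lambda F n q := by
  intro h
  refine ((mem_Lambda_iff hσ hσ4 hn hqn hF rfl rfl rfl rfl).1 h).1 ?_
  rw [hb, CharTwo.add_self_eq_zero, map_zero, add_zero]

end derivative
/-! ### The differential spectrum -/

theorem diffCount_one {F : Type*} [Field F] (d : ℕ) (b : F) :
    diffCount (fun x : F => x ^ d) 1 b = {x : F | x ^ d + (x + 1) ^ d = b}.ncard := by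
  simp only [diffCount, add_comm]

theorem diffCount_pow {F : Type*} [Field F] [Finite F] (d : ℕ) {a : F} (ha : a ≠ 0) (b : F) :
    diffCount (fun x : F => x ^ d) a b = diffCount (fun x : F => x ^ d) 1 (b / a ^ d) := by
  have h : {x : F | (a + x) ^ d + x ^ d = b} =
      (fun x => a * x) '' {x : F | (1 + x) ^ d + x ^ d = b / a ^ d} := by
    ext x
    simp only [Set.mem_ofPred_eq, Set.mem_image]
    have key : ∀ y : F, (a + a * y) ^ d + (a * y) ^ d = a ^ d * ((1 + y) ^ d + y ^ d) := by
      intro y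
      rw [mul_pow, ← mul_one_add, mul_pow]; ring
    constructor
    · rintro rfl
      refine ⟨x / a, ?_, by field_simp⟩
      rw [eq_div_iff (pow_ne_zero d ha), mul_comm, ← key, mul_div_cancel₀ _ ha]
    · rintro ⟨y, hy, rfl⟩
      rw [key, hy, mul_div_cancel₀ _ (pow_ne_zero d ha)]
  unfold diffCount
  rw [h, Set.ncard_image_of_injective _ (mul_right_injective₀ ha)]

theorem theorem1 (n : ℕ) (hn : 1 ≤ n) (q : ℕ) (hq : q = 2 ^ n)
    (d : ℕ) (hd : d = q ^ 3 + q ^ 2 + q - 1)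
    (F : Type*) [Field F] [Finite F] (hF : Nat.card F = q ^ 4) :
    -- the number of solutions, for every right-hand side
    (∀ b : F,
      (b = 1 → {x : F | x ^ d + (x + 1) ^ d = b}.ncard = q ^ 2) ∧
      (b ∈ rootsSet F (q + 1) \ {1} →
        {x : F | x ^ d + (x + 1) ^ d = b}.ncard = q ^ 2 - q) ∧
      (b ∈ Lambda F n q → {x : F | x ^ d + (x + 1) ^ d = b}.ncard = 2) ∧
      (b ≠ 1 → b ∉ rootsSet F (q + 1) \ {1} → b ∉ Lambda F n q →
        {x : F | x ^ d + (x + 1) ^ d = b}.ncard = 0)) ∧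
    -- the differential spectrum
    diffUniformity (fun x : F => x ^ d) = q ^ 2 ∧
    (diffSpectrum (fun x : F => x ^ d) 0 : ℚ) = (1 / 2 * (q : ℚ) ^ 3 - 1) * ((q : ℚ) + 1) ∧
    diffSpectrum (fun x : F => x ^ d) (q ^ 2) = 1 ∧
    (2 ≤ n →
      (diffSpectrum (fun x : F => x ^ d) 2 : ℚ) = 1 / 2 * (q : ℚ) ^ 3 * ((q : ℚ) - 1) ∧
      diffSpectrum (fun x : F => x ^ d) (q ^ 2 - q) = q) ∧
    -- for `q = 2` the indices `2` and `q ^ 2 - q` coincide and the two entries add up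
    (n = 1 →
      (diffSpectrum (fun x : F => x ^ d) 2 : ℚ) =
        1 / 2 * (q : ℚ) ^ 3 * ((q : ℚ) - 1) + (q : ℚ)) ∧
    (∀ i : ℕ, i ≠ 0 → i ≠ 2 → i ≠ q ^ 2 - q → i ≠ q ^ 2 →
      diffSpectrum (fun x : F => x ^ d) i = 0) ∧
    -- the conjecture of Budaghyan et al.
    (∃ (b₀ : F) (S : Finset F), b₀ ∉ S ∧ S.card = q ∧
      {x : F | x ^ d + (x + 1) ^ d = b₀}.ncard = q ^ 2 ∧
      (∀ b ∈ S, {x : F | x ^ d + (x + 1) ^ d = b}.ncard = q ^ 2 - q) ∧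
      (∀ b : F, b ≠ b₀ → b ∉ S → {x : F | x ^ d + (x + 1) ^ d = b}.ncard ≤ 2)) := by
  classical
  have hfin := Fintype.ofFinite F
  have hq2 : 2 ≤ q := by
    rw [hq]; exact (pow_one 2).symm.le.trans (Nat.pow_le_pow_right (by norm_num) hn)
  have hqq : q + q ≤ q ^ 2 := by nlinarith
  have hchar : CharP F 2 := by
    have hFc : Fintype.card F = 2 ^ (n * 4) := by
      rw [← Nat.card_eq_fintype_card, hF, hq, ← pow_mul]
    exact charP_of_card_eq_prime_pow hFc
  obtain ⟨σ, hσ⟩ : ∃ σ : F →+* F, ∀ x, σ x = x ^ q :=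
    ⟨iterateFrobenius F 2 n, fun x => by rw [iterateFrobenius_def, hq]⟩
  have hσ4 : ∀ x, σ (σ (σ (σ x))) = x := by
    intro x
    simp only [hσ, ← pow_mul]
    have : q * q * q * q = Fintype.card F := by
      rw [← Nat.card_eq_fintype_card, hF]; ring
    rw [this, FiniteField.pow_card]
  set N : F → ℕ := fun b => {x : F | x ^ d + (x + 1) ^ d = b}.ncard with hN
  set M : Set F := rootsSet F (q + 1) \ {1} with hM
  set L : Set F := Lambda F n q with hL
  have c1 : N 1 = q ^ 2 := ncard_deriv_fibre_one hσ hσ4 hF hq2 hd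
  have c2 : ∀ b ∈ M, N b = q ^ 2 - q := fun b hb =>
    ncard_deriv_fibre_unit hσ hσ4 hq hF hq2 hd hb
  have c3 : ∀ b ∈ L, N b = 2 := fun b hb =>
    ncard_deriv_fibre_Lambda hσ hσ4 hn hq hF hq2 hd hb
  have c4 : ∀ b, b ≠ 1 → b ∉ M → b ∉ L → N b = 0 := by
    intro b h1 h2 h3
    refine (Set.ncard_eq_zero).2 (Set.eq_empty_iff_forall_notMem.2 fun x hx => ?_)
    rcases mem_rootsSet_or_mem_Lambda hσ hσ4 hn hq hF hq2 hd h1 hx with h | h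
    · exact h2 ⟨h, h1⟩
    · exact h3 h
  have hM1 : (1 : F) ∉ M := fun h => h.2 rfl
  have hL1 : (1 : F) ∉ L := not_mem_Lambda_of_fixed hσ hσ4 hn hq hF (by simp)
  have hML : Disjoint M L := by
    refine Set.disjoint_left.2 fun b hb => not_mem_Lambda_of_fixed hσ hσ4 hn hq hF ?_
    have h1 := (mem_rootsSet_iff hσ).1 hb.1
    have h2 := congrArg σ h1
    rw [map_mul, map_one] at h2
    have h3 : σ b ≠ 0 := left_ne_zero_of_mul (by rw [h1]; exact one_ne_zero)
    exact mul_right_cancel₀ h3 (by rw [h2, mul_comm, h1])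
  have hMcard : M.ncard = q := by
    have h1 : rootsSet F (q + 1) = {x : F | x ^ (q + 1) = 1} := by
      ext x
      rw [mem_rootsSet_iff hσ, hσ, ← pow_succ]; rfl
    have h2 : (rootsSet F (q + 1)).ncard = q + 1 := by
      rw [h1]
      exact ncard_pow_eq_one (by omega)
        ((Dvd.intro_left _ rfl).trans (dvd_card_sub_one hF (by omega)))
    rw [hM, Set.ncard_sdiff_singleton_of_mem (by rw [h1]; simp), h2, Nat.add_sub_cancel]
  have hsum : ∑ b, N b = q ^ 4 := by
    have h := Finset.card_eq_sum_card_fiberwise (f := fun x : F => x ^ d + (x + 1) ^ d)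
      (s := Finset.univ) (t := Finset.univ) (fun _ _ => Finset.mem_coe.2 (Finset.mem_univ _))
    rw [Finset.card_univ, ← Nat.card_eq_fintype_card, hF] at h
    rw [h]
    refine Finset.sum_congr rfl fun b _ => ?_
    rw [hN, ← Set.ncard_coe_finset]
    simp
  have hNval : ∀ b, N b = (if b = 1 then q ^ 2 else 0) + (if b ∈ M then q ^ 2 - q else 0) +
      (if b ∈ L then 2 else 0) := by
    intro b
    by_cases h1 : b = 1
    · subst h1; simp [hM1, hL1, c1]
    · by_cases h2 : b ∈ M
      · simp [h1, h2, Set.disjoint_left.1 hML h2, c2]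
      · by_cases h3 : b ∈ L
        · simp [h1, h2, h3, c3]
        · simp [h1, h2, h3, c4]
  have hcardset : ∀ (A : Set F) [DecidablePred (· ∈ A)] (k : ℕ),
      ∑ b, (if b ∈ A then k else 0) = A.ncard * k := by
    intro A _ k
    rw [← Finset.sum_filter, Finset.sum_const, smul_eq_mul, ← Set.ncard_coe_finset]
    simp
  -- Summing the fibre sizes over all `b` determines the size of `Λ`.
  have hLcard : q ^ 2 + q * (q ^ 2 - q) + L.ncard * 2 = q ^ 4 := by
    rw [← hsum, Finset.sum_congr rfl fun b _ => hNval b, Finset.sum_add_distrib,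
      Finset.sum_add_distrib, hcardset, hcardset, hMcard]
    simp
  have hLq : (L.ncard : ℚ) = 1 / 2 * (q : ℚ) ^ 3 * ((q : ℚ) - 1) := by
    have h := congrArg (Nat.cast : ℕ → ℚ) hLcard
    push_cast [Nat.cast_sub (by omega : q ≤ q ^ 2)] at h
    linear_combination h / 2
  have hspec : ∀ i, diffSpectrum (fun x : F => x ^ d) i = {b | N b = i}.ncard := by
    intro i
    simp only [diffSpectrum, diffCount_one, hN]
  have hNle : ∀ b, N b ≤ q ^ 2 := by
    intro b
    by_cases h1 : b = 1
    · rw [h1, c1]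
    · by_cases h2 : b ∈ M
      · rw [c2 b h2]; omega
      · by_cases h3 : b ∈ L
        · rw [c3 b h3]; omega
        · rw [c4 b h1 h2 h3]; omega
  have hunion : (insert 1 (M ∪ L) : Set F).ncard = 1 + q + L.ncard := by
    rw [Set.ncard_insert_of_notMem (by simp [hM1, hL1]), Set.ncard_union_eq hML, hMcard]; ring
  refine ⟨fun b => ⟨?_, c2 b, c3 b, c4 b⟩, ?_, ?_, ?_, ?_, ?_, ?_, ?_⟩
  · rintro rfl; exact c1
  · refine IsGreatest.csSup_eq ⟨⟨1, 1, one_ne_zero, ?_⟩, ?_⟩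
    · rw [diffCount_one]; exact c1
    · rintro k ⟨a, b, ha, rfl⟩
      rw [diffCount_pow d ha, diffCount_one]
      exact hNle _
  · have h0 : {b | N b = 0} = (insert 1 (M ∪ L) : Set F)ᶜ := by
      ext b
      simp only [Set.mem_ofPred_eq, Set.mem_compl_iff, Set.mem_insert_iff, Set.mem_union, not_or]
      refine ⟨fun h => ⟨?_, ?_, ?_⟩, fun h => c4 b h.1 h.2.1 h.2.2⟩
      · rintro rfl; rw [c1] at h; omega
      · intro hb; rw [c2 b hb] at h; omega
      · intro hb; rw [c3 b hb] at h; omega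
    have h1 := Set.ncard_add_ncard_compl (insert 1 (M ∪ L) : Set F)
    rw [← h0, hunion, hF] at h1
    have h2 := congrArg (Nat.cast : ℕ → ℚ) h1
    push_cast at h2
    rw [hspec]
    linear_combination h2 - hLq
  · rw [hspec]
    have : {b | N b = q ^ 2} = {1} := by
      ext b
      rw [Set.mem_ofPred_eq, Set.mem_singleton_iff]
      refine ⟨fun h => ?_, by rintro rfl; exact c1⟩
      by_contra h1
      by_cases h2 : b ∈ M
      · rw [c2 b h2] at h; omega
      · by_cases h3 : b ∈ L
        · rw [c3 b h3] at h; omega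
        · rw [c4 b h1 h2 h3] at h; omega
    rw [this, Set.ncard_singleton]
  · intro hn2
    have hq4 : 4 ≤ q := by
      rw [hq]; exact (by norm_num : 4 = 2 ^ 2).le.trans (Nat.pow_le_pow_right (by norm_num) hn2)
    have hq4' : 4 * q ≤ q ^ 2 := by nlinarith
    have e2 : {b | N b = 2} = L := by
      ext b
      refine ⟨fun h => ?_, c3 b⟩
      rw [Set.mem_ofPred_eq] at h
      by_contra h3
      by_cases h1 : b = 1
      · rw [h1, c1] at h; omega
      · by_cases h2 : b ∈ M
        · rw [c2 b h2] at h; omega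
        · rw [c4 b h1 h2 h3] at h; omega
    have eM : {b | N b = q ^ 2 - q} = M := by
      ext b
      refine ⟨fun h => ?_, c2 b⟩
      rw [Set.mem_ofPred_eq] at h
      by_contra h2
      by_cases h1 : b = 1
      · rw [h1, c1] at h; omega
      · by_cases h3 : b ∈ L
        · rw [c3 b h3] at h; omega
        · rw [c4 b h1 h2 h3] at h; omega
    rw [hspec, hspec, e2, eM]
    exact ⟨hLq, hMcard⟩
  · rintro rfl
    have hq2' : q = 2 := by rw [hq]; norm_num
    have e2 : {b | N b = 2} = M ∪ L := by
      ext b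
      rw [Set.mem_ofPred_eq, Set.mem_union]
      refine ⟨fun h => ?_, ?_⟩
      · by_contra h3
        rw [not_or] at h3
        by_cases h1 : b = 1
        · rw [h1, c1, hq2'] at h; omega
        · rw [c4 b h1 h3.1 h3.2] at h; omega
      · rintro (h | h)
        · simp [c2 b h, hq2']
        · exact c3 b h
    rw [hspec, e2, Set.ncard_union_eq hML, hMcard, Nat.cast_add, hLq, add_comm]
  · intro i h0 h2 hM' h1'
    rw [hspec, Set.ncard_eq_zero, Set.eq_empty_iff_forall_notMem]
    intro b hb
    rw [Set.mem_ofPred_eq] at hb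
    by_cases h1 : b = 1
    · rw [h1, c1] at hb; exact h1' hb.symm
    · by_cases h3 : b ∈ M
      · rw [c2 b h3] at hb; exact hM' hb.symm
      · by_cases h4 : b ∈ L
        · rw [c3 b h4] at hb; exact h2 hb.symm
        · rw [c4 b h1 h3 h4] at hb; exact h0 hb.symm
  · refine ⟨1, M.toFinset, by simpa using hM1, ?_, c1, fun b hb => c2 b (by simpa using hb),
      fun b hb1 hbM => ?_⟩
    · rw [← Set.ncard_eq_toFinset_card', hMcard]
    · rw [Set.mem_toFinset] at hbM
      by_cases h3 : b ∈ L
      · exact (c3 b h3).le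
      · exact (c4 b hb1 hbM h3).le.trans (by norm_num)
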